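/- Let $N\in\mathbb N$, let $\rho$ be a Borel probability measure on $\mathbb R^3$, and let $$c(x_1,\dots,x_N)=\sum_{1\le i<j\le N}\frac1{|x_i-x_j|}\in[0,+\infty]$$ be the Coulomb cost on $(\mathbb R^3)^N=\mathbb R^{3N}$ (with $1/0=+\infty$). Let $\Pi(\rho)$ be the set of Borel probability measures on $\mathbb R^{3N}$ all of whose $N$ marginals on $\mathbb R^3$ are equal to $\rho$, and for a Borel probability measure $P$ on $\mathbb R^{3N}$ put $K(c,P)=\int c\,dP$ if $P\in\Pi(\rho)$ and $K(c,P)=+\infty$ otherwise. For $\alpha>0$ let $$D_\alpha=\{(x_1,\dots,x_N)\in\mathbb R^{3N} : |x_i-x_j|\le\alpha \text{ for some } i\neq j\}.$$ Assume that $\rho$ has no atoms, i.e. $\rho(\{x\})=0$ for every $x\in\mathbb R^3$. Then there exists $\alpha>0$ such that $P(D_\alpha)=0$ for every minimizer $P$ of $K(c,\cdot)$ over the Borel probability measures on $\mathbb R^{3N}$. -/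

import Mathlib

open MeasureTheory
open scoped ENNReal

/-- The physical space `ℝ³` with its Euclidean norm. -/
abbrev E3 : Type := EuclideanSpace ℝ (Fin 3)

/-- The configuration space `ℝ^{3N} = (ℝ³)^N`; it carries the product (= Borel) σ-algebra. -/
abbrev Config (N : ℕ) : Type := Fin N → E3

/-- The Coulomb cost `c(x₁, …, x_N) = ∑_{i < j} 1 / |x_i - x_j|`, with values in `[0, +∞]`.
It equals `+∞` as soon as two of the points coincide, since `0⁻¹ = ∞` in `ℝ≥0∞`. -/
noncomputable def coulombCost {N : ℕ} (x : Config N) : ℝ≥0∞ :=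
  ∑ i : Fin N, ∑ j ∈ Finset.Ioi i, (ENNReal.ofReal ‖x i - x j‖)⁻¹

/-- The set `Π(ρ)` of transport plans: the probability measures on `ℝ^{3N}` all of whose `N`
marginals are equal to `ρ`. -/
def transportPlans (N : ℕ) (ρ : ProbabilityMeasure E3) :
    Set (ProbabilityMeasure (Config N)) :=
  {P | ∀ i : Fin N, (P : Measure (Config N)).map (fun x => x i) = (ρ : Measure E3)}

open Classical in
/-- The transport functional `K(c, ·) : 𝒫(ℝ^{3N}) → [0, +∞]`, equal to `∫ c dP` if `P ∈ Π(ρ)`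
and to `+∞` otherwise. -/
noncomputable def transportFunctional {N : ℕ} (c : Config N → ℝ≥0∞)
    (ρ : ProbabilityMeasure E3) (P : ProbabilityMeasure (Config N)) : ℝ≥0∞ :=
  if P ∈ transportPlans N ρ then ∫⁻ x, c x ∂(P : Measure (Config N)) else ⊤

/-- The closed strip around the diagonals,
`D_α = {x : |x_i - x_j| ≤ α for some i ≠ j}`. -/
def diagonalStrip (N : ℕ) (α : ℝ) : Set (Config N) :=
  {x | ∃ i j : Fin N, i ≠ j ∧ ‖x i - x j‖ ≤ α}

/-! Draw x and y independently from a minimizer P and exchange their i-th points. If x_i and x_j are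
within α, while each exchanged point is at distance at least β from the other points of its new
configuration, the exchange removes a term of size at least 1/α and creates interactions of total
size at most 2N/β. With 1/α = 2N/β + 1 the cost drops by at least 1. Performing the exchange on any
measurable set of pairs and averaging the two resulting laws gives another plan
(`averageMarginal_exchange_plan`), so if P has finite cost, the favourable pairs are P ⊗ P-null
(`prod_exchangeSet_eq_zero`). Since ρ has no atoms, β can be chosen so that balls of radius β have
mass less than 1/(2N); by a union bound every x then has a non-null set of favourable partners y
(`measure_far_pos`). By Fubini, the x with |x_i - x_j| ≤ α form a null set. The choice of α involves
only N and ρ. Finiteness of the minimum comes from an explicit plan: cut space into 2N slabs of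
equal mass and put x_i in slab k + 2i modulo 2N, with k uniform (`exists_separated_plan`). -/

/-! ### Slabs of equal mass and small balls for an atomless measure -/

open Filter Topology in
/-- A finite atomless measure on `ℝ³` has a linear projection whose level sets are all null. -/
theorem exists_inner_level_null (μ : Measure E3) [IsFiniteMeasure μ] (hμ : ∀ x, μ {x} = 0) :
    ∃ e : E3, ∀ t : ℝ, μ {x | inner ℝ e x = t} = 0 := by
  set Z : Set (E3 × (E3 × E3)) := {p | inner ℝ p.1 (p.2.1 - p.2.2) = 0} with hZ
  have hZm : MeasurableSet Z :=
    measurableSet_eq_fun (by fun_prop) measurable_const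
  have hdiag : ∀ᵐ q ∂(μ.prod μ), q.1 ≠ q.2 := by
    have hm : MeasurableSet {q : E3 × E3 | q.1 ≠ q.2} :=
      (measurableSet_eq_fun measurable_fst measurable_snd).compl
    rw [Measure.ae_prod_iff_ae_ae hm]
    refine Eventually.of_forall fun x => ?_
    have h := hμ x
    rw [measure_eq_zero_iff_ae_notMem] at h
    filter_upwards [h] with y hy hxy
    exact hy hxy.symm
  -- For fixed x ≠ y the directions e orthogonal to x - y form a Lebesgue-null hyperplane; Fubini is
  -- used in this order here, and in the other order below to select e.
  have hZ0 : ((volume : Measure E3).prod (μ.prod μ)) Z = 0 := by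
    rw [← Measure.prod_swap, Measure.map_apply measurable_swap hZm,
      Measure.measure_prod_null (measurable_swap hZm)]
    filter_upwards [hdiag] with q hq
    have hne : (LinearMap.ker (innerSL ℝ (q.1 - q.2)).toLinearMap) ≠ ⊤ := by
      intro h
      have : (q.1 - q.2) ∈ LinearMap.ker (innerSL ℝ (q.1 - q.2)).toLinearMap := by
        rw [h]; trivial
      simp only [LinearMap.mem_ker, ContinuousLinearMap.coe_coe, innerSL_apply_apply,
        inner_self_eq_zero] at this
      exact hq (sub_eq_zero.1 this)
    have h0 := Measure.addHaar_submodule (volume : Measure E3) _ hne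
    refine measure_mono_null ?_ h0
    intro e he
    have he' : inner ℝ e (q.1 - q.2) = 0 := he
    change inner ℝ (q.1 - q.2) e = 0
    rwa [real_inner_comm]
  rw [Measure.measure_prod_null hZm] at hZ0
  obtain ⟨e, he⟩ := hZ0.exists
  refine ⟨e, fun t => ?_⟩
  have hsub : {x : E3 | inner ℝ e x = t} ×ˢ {x : E3 | inner ℝ e x = t} ⊆ Prod.mk e ⁻¹' Z := by
    rintro ⟨x, y⟩ ⟨hx, hy⟩
    have hx' : inner ℝ e x = t := hx
    have hy' : inner ℝ e y = t := hy
    change inner ℝ e (x - y) = 0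
    rw [inner_sub_right, hx', hy', sub_self]
  have h := measure_mono_null hsub he
  rw [Measure.prod_prod] at h
  exact mul_self_eq_zero.1 h

open Filter Topology in
/-- The distribution function of an atomless probability measure on `ℝ` takes every value in
`(0, 1)`. -/
theorem exists_measureReal_Iic_eq (ν : Measure ℝ) [IsProbabilityMeasure ν] [NullSingletonClass ν]
    {u : ℝ} (h0 : 0 < u) (h1 : u < 1) : ∃ a, ν.real (Set.Iic a) = u := by
  have hc : Continuous (ProbabilityTheory.cdf ν) := by
    refine continuous_iff_continuousAt.2 fun a => ?_
    rw [(ProbabilityTheory.monotone_cdf ν).continuousAt_iff_leftLim_eq_rightLim,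
      StieltjesFunction.rightLim_eq]
    -- The jump of the distribution function at `a` is the mass of the atom `a`, hence zero.
    have h := StieltjesFunction.measure_singleton (ProbabilityTheory.cdf ν) a
    rw [ProbabilityTheory.measure_cdf, measure_singleton, eq_comm, ENNReal.ofReal_eq_zero] at h
    exact le_antisymm ((ProbabilityTheory.monotone_cdf ν).leftLim_le le_rfl) (by linarith)
  obtain ⟨b, hb⟩ := ((ProbabilityTheory.tendsto_cdf_atBot ν).eventually (gt_mem_nhds h0)).exists
  obtain ⟨d, hd⟩ := ((ProbabilityTheory.tendsto_cdf_atTop ν).eventually (lt_mem_nhds h1)).exists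
  obtain ⟨a, ha⟩ := mem_range_of_exists_le_of_exists_ge hc ⟨b, hb.le⟩ ⟨d, hd.le⟩
  exact ⟨a, by rw [← ProbabilityTheory.cdf_eq_real, ha]⟩

open Filter Topology in
/-- An atomless probability measure on `ℝ` can be cut into `m + 1` consecutive intervals of equal
mass, so that close points lie in the same or in adjacent intervals. -/
theorem exists_equal_mass_intervals (ν : Measure ℝ) [IsProbabilityMeasure ν] [NullSingletonClass ν] (m : ℕ) :
    ∃ (κ : ℝ → Fin (m + 1)) (δ : ℝ), Measurable κ ∧ 0 < δ ∧
      (∀ k, ν (κ ⁻¹' {k}) = ((m + 1 : ℕ) : ℝ≥0∞)⁻¹) ∧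
      ∀ s t, |s - t| ≤ δ → (κ s : ℕ) ≤ κ t + 1 := by
  have hM : (0 : ℝ) < m + 1 := by positivity
  have hq : ∀ k : ℕ, ∃ a, k < m → ν.real (Set.Iic a) = (k + 1) / (m + 1) := by
    intro k
    by_cases hk : k < m
    · have hk' : (k : ℝ) < m := by exact_mod_cast hk
      obtain ⟨a, ha⟩ := exists_measureReal_Iic_eq ν (u := (k + 1) / (m + 1)) (by positivity)
        (by rw [div_lt_one hM]; linarith)
      exact ⟨a, fun _ => ha⟩
    · exact ⟨0, fun h => absurd h hk⟩
  choose a ha using hq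
  have hlt : ∀ j k, j < k → k < m → a j < a k := by
    intro j k hjk hk
    by_contra! h
    have h1 : ν.real (Set.Iic (a k)) ≤ ν.real (Set.Iic (a j)) :=
      measureReal_mono (Set.Iic_subset_Iic.2 h)
    rw [ha k hk, ha j (hjk.trans hk), div_le_div_iff_of_pos_right hM] at h1
    have : (j : ℝ) < k := by exact_mod_cast hjk
    linarith
  -- The cell index of t is the number of quantiles strictly below t.
  set c : ℝ → ℕ := fun t => ((Finset.range m).filter (fun k => a k < t)).card with hc
  have hcm : ∀ t, c t < m + 1 := fun t =>
    Nat.lt_succ_of_le ((Finset.card_filter_le _ _).trans_eq (Finset.card_range m))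
  have hc_iff : ∀ k, k < m → ∀ t, c t ≤ k ↔ t ≤ a k := by
    intro k hk t
    constructor
    · intro h
      by_contra! hlt'
      have : Finset.range (k + 1) ⊆ (Finset.range m).filter (fun k => a k < t) := by
        intro j hj
        simp only [Finset.mem_range, Finset.mem_filter] at hj ⊢
        refine ⟨by omega, ?_⟩
        rcases Nat.lt_succ_iff_lt_or_eq.1 hj with h' | rfl
        · exact (hlt j k h' hk).trans hlt'
        · exact hlt'
      have := Finset.card_le_card this
      rw [Finset.card_range] at this
      exact absurd (this.trans h) (by omega)
    · intro h
      have : (Finset.range m).filter (fun k => a k < t) ⊆ Finset.range k := by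
        intro j hj
        simp only [Finset.mem_range, Finset.mem_filter] at hj ⊢
        by_contra! hkj
        have : a k ≤ a j := by
          rcases hkj.lt_or_eq with h' | rfl
          · exact (hlt k j h' hj.1).le
          · exact le_rfl
        linarith [hj.2]
      simpa using Finset.card_le_card this
  have hcmeas : Measurable c := by
    simp only [hc, Finset.card_filter]
    refine Finset.measurable_sum _ fun k _ => ?_
    exact Measurable.ite measurableSet_Ioi measurable_const measurable_const
  have hmass : ∀ k, k ≤ m → ν.real {t | c t ≤ k} = (k + 1) / (m + 1) := by
    intro k hk
    rcases hk.lt_or_eq with hk | rfl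
    · rw [← ha k hk]
      congr 1
      ext t
      exact hc_iff k hk t
    · have : {t | c t ≤ k} = Set.univ := Set.eq_univ_of_forall fun t => Nat.lt_succ_iff.1 (hcm t)
      rw [this, div_self hM.ne']
      simp
  have hmass' : ∀ k, k ≤ m → ν.real {t | c t = k} = 1 / (m + 1) := by
    intro k hk
    rcases k with _ | k
    · have := hmass 0 hk
      simpa using this
    · have hd : {t | c t = k + 1} = {t | c t ≤ k + 1} \ {t | c t ≤ k} := by
        ext t
        simp only [Set.mem_ofPred_eq, Set.mem_sdiff]
        omega
      have hsub : {t | c t ≤ k} ⊆ {t | c t ≤ k + 1} :=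
        fun t (ht : c t ≤ k) => show c t ≤ k + 1 by omega
      have hmeas : MeasurableSet {t | c t ≤ k} := hcmeas measurableSet_Iic
      rw [hd, measureReal_sdiff hsub hmeas, hmass _ hk, hmass _ (by omega)]
      push_cast
      ring
  obtain ⟨δ, hδ, hgap⟩ : ∃ δ : ℝ, 0 < δ ∧ ∀ k ∈ Finset.range m, k + 1 < m → a k + δ < a (k + 1) := by
    have h : ∀ᶠ δ in 𝓝[>] (0 : ℝ), ∀ k ∈ Finset.range m, k + 1 < m → a k + δ < a (k + 1) := by
      refine (Filter.eventually_all_finset _).2 fun k _ => ?_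
      by_cases hk : k + 1 < m
      · have hpos := hlt k (k + 1) (by omega) hk
        filter_upwards [Ioo_mem_nhdsGT (sub_pos.2 hpos)] with δ hδ _
        linarith [hδ.2]
      · exact Eventually.of_forall fun _ h => absurd h hk
    exact (eventually_mem_nhdsWithin.and h).exists
  refine ⟨fun t => ⟨c t, hcm t⟩, δ, ?_, hδ, ?_, ?_⟩
  · refine measurable_to_countable' fun k => ?_
    have : (fun t => (⟨c t, hcm t⟩ : Fin (m + 1))) ⁻¹' {k} = c ⁻¹' {(k : ℕ)} := by
      ext t; simp [Fin.ext_iff]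
    rw [this]
    exact hcmeas (measurableSet_singleton _)
  · intro k
    have : (fun t => (⟨c t, hcm t⟩ : Fin (m + 1))) ⁻¹' {k} = {t | c t = (k : ℕ)} := by
      ext t; simp [Fin.ext_iff]
    rw [this, ← ENNReal.ofReal_toReal (measure_ne_top ν _)]
    have h := hmass' k (by omega)
    rw [measureReal_def] at h
    rw [h, one_div, ENNReal.ofReal_inv_of_pos hM]
    congr 1
    rw [← Nat.cast_succ, ENNReal.ofReal_natCast]
  · intro s t hst
    by_cases ht : c t + 1 < m
    · have h1 : t ≤ a (c t) := (hc_iff (c t) (by omega) t).1 le_rfl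
      have h2 := hgap (c t) (Finset.mem_range.2 (by omega)) ht
      exact (hc_iff (c t + 1) ht s).2 (by linarith [(abs_le.1 hst).2])
    -- Here t lies in one of the last two cells, so the bound is automatic.
    · have := hcm s
      change c s ≤ c t + 1
      omega

/-- An atomless probability measure on `ℝ³` can be cut into `m + 1` consecutive slabs of equal
mass, so that close points lie in the same or in adjacent slabs. -/
theorem exists_equal_mass_slabs (μ : Measure E3) [IsProbabilityMeasure μ] (hμ : ∀ x, μ {x} = 0)
    (m : ℕ) :
    ∃ (κ : E3 → Fin (m + 1)) (δ : ℝ), Measurable κ ∧ 0 < δ ∧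
      (∀ k, μ (κ ⁻¹' {k}) = ((m + 1 : ℕ) : ℝ≥0∞)⁻¹) ∧
      ∀ x y, ‖x - y‖ ≤ δ → (κ x : ℕ) ≤ κ y + 1 := by
  obtain ⟨e, he⟩ := exists_inner_level_null μ hμ
  have hf : Measurable fun x : E3 => inner ℝ e x := by fun_prop
  have : IsProbabilityMeasure (μ.map fun x => inner ℝ e x) :=
    Measure.isProbabilityMeasure_map hf.aemeasurable
  have : NullSingletonClass (μ.map fun x => inner ℝ e x) :=
    ⟨fun t => by rw [Measure.map_apply hf (measurableSet_singleton t)]; exact he t⟩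
  obtain ⟨κ, δ, hκ, hδ, hmass, hadj⟩ := exists_equal_mass_intervals (μ.map fun x => inner ℝ e x) m
  -- The summand 1 makes the divisor positive without a separate proof that `e ≠ 0`.
  have he0 : 0 < ‖e‖ + 1 := by positivity
  refine ⟨fun x => κ (inner ℝ e x), δ / (‖e‖ + 1), hκ.comp hf, by positivity, fun k => ?_,
    fun x y hxy => hadj _ _ ?_⟩
  · rw [← hmass k, Measure.map_apply hf (hκ (measurableSet_singleton k))]
    rfl
  · rw [← inner_sub_right]
    rw [le_div_iff₀ he0] at hxy
    refine (abs_real_inner_le_norm _ _).trans ?_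
    nlinarith [norm_nonneg (x - y)]

/-- Small balls have uniformly small mass for an atomless probability measure. -/
theorem exists_measure_ball_lt (μ : Measure E3) [IsProbabilityMeasure μ] (hμ : ∀ x, μ {x} = 0)
    (n : ℕ) :
    ∃ β : ℝ, 0 < β ∧ ∀ x, (n : ℝ≥0∞) * μ {y | ‖x - y‖ < β} < 1 := by
  -- A ball of radius δ meets at most three slabs, so its mass is at most 3/(3n + 1) < 1/n when n >
  -- 0.
  obtain ⟨κ, δ, hκ, hδ, hmass, hadj⟩ := exists_equal_mass_slabs μ hμ (3 * n)
  refine ⟨δ, hδ, fun x => ?_⟩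
  set S : Finset (Fin (3 * n + 1)) :=
    Finset.univ.filter fun k => (k : ℕ) ≤ κ x + 1 ∧ (κ x : ℕ) ≤ k + 1 with hS
  have hcard : S.card ≤ 3 := by
    have h : S.card ≤ (Finset.Icc ((κ x : ℕ) - 1) (κ x + 1)).card := by
      refine Finset.card_le_card_of_injOn (fun k => (k : ℕ)) ?_ Fin.val_injective.injOn
      intro k hk
      have hk' : k ∈ S := hk
      simp only [hS, Finset.mem_filter, Finset.mem_univ, true_and] at hk'
      simp only [Finset.coe_Icc, Set.mem_Icc]
      omega
    refine h.trans ?_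
    rw [Nat.card_Icc]
    omega
  have hsub : {y | ‖x - y‖ < δ} ⊆ ⋃ k ∈ S, κ ⁻¹' {k} := by
    intro y hy
    have hy' : ‖x - y‖ < δ := hy
    have h1 := hadj x y hy'.le
    have h2 := hadj y x (by rw [norm_sub_rev]; exact hy'.le)
    simp only [Set.mem_iUnion, Set.mem_preimage, Set.mem_singleton_iff, exists_prop,
      exists_eq_right', hS, Finset.mem_filter, Finset.mem_univ, true_and]
    exact ⟨h2, h1⟩
  have hle : μ {y | ‖x - y‖ < δ} ≤ 3 * ((3 * n + 1 : ℕ) : ℝ≥0∞)⁻¹ := by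
    refine (measure_mono hsub).trans ((measure_biUnion_finset_le _ _).trans ?_)
    simp only [hmass, Finset.sum_const, nsmul_eq_mul]
    gcongr
    exact_mod_cast hcard
  calc (n : ℝ≥0∞) * μ {y | ‖x - y‖ < δ} ≤ n * (3 * ((3 * n + 1 : ℕ) : ℝ≥0∞)⁻¹) := by gcongr
    _ = ((3 * n : ℕ) : ℝ≥0∞) / ((3 * n + 1 : ℕ) : ℝ≥0∞) := by
        rw [div_eq_mul_inv]; push_cast; ring
    _ < 1 := by
        rw [ENNReal.div_lt_iff (Or.inl (by simp))
          (Or.inl (ENNReal.natCast_ne_top _)), one_mul]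
        exact_mod_cast Nat.lt_succ_self _

/-! ### The cost as a function of one point -/

/-- Separating the terms with a given index `i` in a symmetric sum over pairs. -/
theorem sum_pairs_eq_add_sum_erase {N : ℕ} (w : Fin N → Fin N → ℝ≥0∞) (hw : ∀ k l, w k l = w l k)
    (i : Fin N) :
    ∑ k, ∑ l ∈ Finset.Ioi k, w k l =
      (∑ k, ∑ l ∈ Finset.Ioi k, if k ≠ i ∧ l ≠ i then w k l else 0) +
        ∑ l ∈ Finset.univ.erase i, w i l := by
  -- Row i consists entirely of pairs containing i; a row k < i contains just one such pair, (k, i).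
  have hsplit : ∀ k, ∑ l ∈ Finset.Ioi k, w k l =
      (∑ l ∈ Finset.Ioi k, if k ≠ i ∧ l ≠ i then w k l else 0) +
        ((if k = i then ∑ l ∈ Finset.Ioi i, w i l else 0) + if k < i then w i k else 0) := by
    intro k
    by_cases hk : k = i
    · subst hk; simp
    · by_cases hki : k < i
      · have hmem : i ∈ Finset.Ioi k := Finset.mem_Ioi.2 hki
        rw [← Finset.add_sum_erase _ _ hmem, ← Finset.add_sum_erase _ _ hmem]
        simp only [hk, hki, ne_eq, not_false_eq_true, not_true_eq_false, and_false, if_false,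
          if_true, zero_add, true_and]
        rw [add_comm, hw k i]
        congr 1
        refine Finset.sum_congr rfl fun l hl => ?_
        rw [if_pos (Finset.ne_of_mem_erase hl)]
      · simp only [hk, hki, if_false, add_zero]
        refine Finset.sum_congr rfl fun l hl => ?_
        have : l ≠ i := by
          rintro rfl
          exact hki (Finset.mem_Ioi.1 hl)
        simp [hk, this]
  rw [Finset.sum_congr rfl fun k _ => hsplit k, Finset.sum_add_distrib, Finset.sum_add_distrib]
  congr 1
  rw [Finset.sum_ite_eq' Finset.univ i, if_pos (Finset.mem_univ i), ← Finset.sum_filter]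
  rw [← Finset.sum_union]
  · congr 1
    ext l
    simp only [Finset.mem_union, Finset.mem_Ioi, Finset.mem_filter, Finset.mem_univ, true_and,
      Finset.mem_erase, and_true]
    rw [← lt_or_lt_iff_ne, or_comm]
  · rw [Finset.disjoint_left]
    intro l hl hl'
    simp only [Finset.mem_Ioi, Finset.mem_filter, Finset.mem_univ, true_and] at hl hl'
    exact lt_asymm hl hl'

/-- The interactions between points other than `x i`. -/
noncomputable def coulombCostWithout {N : ℕ} (i : Fin N) (x : Config N) : ℝ≥0∞ :=
  ∑ k : Fin N, ∑ l ∈ Finset.Ioi k, if k ≠ i ∧ l ≠ i then (ENNReal.ofReal ‖x k - x l‖)⁻¹ else 0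

theorem coulombCost_eq {N : ℕ} (i : Fin N) (x : Config N) :
    coulombCost x = coulombCostWithout i x +
      ∑ l ∈ Finset.univ.erase i, (ENNReal.ofReal ‖x i - x l‖)⁻¹ :=
  sum_pairs_eq_add_sum_erase _ (fun k l => by rw [norm_sub_rev]) i

theorem coulombCostWithout_update {N : ℕ} (i : Fin N) (x : Config N) (z : E3) :
    coulombCostWithout i (Function.update x i z) = coulombCostWithout i x := by
  refine Finset.sum_congr rfl fun k _ => Finset.sum_congr rfl fun l _ => ?_
  split_ifs with h
  · rw [Function.update_of_ne h.1, Function.update_of_ne h.2]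
  · rfl

theorem measurable_coulombCost {N : ℕ} : Measurable (coulombCost : Config N → ℝ≥0∞) := by
  unfold coulombCost
  refine Finset.measurable_sum _ fun i _ => Finset.measurable_sum _ fun j _ => ?_
  fun_prop

theorem coulombCost_update_le {N : ℕ} (i : Fin N) (x : Config N) (z : E3) {β : ℝ} (hβ : 0 < β)
    (h : ∀ k, k ≠ i → β ≤ ‖z - x k‖) :
    coulombCost (Function.update x i z) ≤
      coulombCostWithout i x + ENNReal.ofReal (N / β) := by
  rw [coulombCost_eq i, coulombCostWithout_update]
  gcongr
  have hterm : ∀ l ∈ Finset.univ.erase i,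
      (ENNReal.ofReal ‖Function.update x i z i - Function.update x i z l‖)⁻¹ ≤
        (ENNReal.ofReal β)⁻¹ := by
    intro l hl
    have hl' := Finset.ne_of_mem_erase hl
    rw [Function.update_self, Function.update_of_ne hl']
    exact ENNReal.inv_le_inv.2 (ENNReal.ofReal_le_ofReal (h l hl'))
  refine (Finset.sum_le_card_nsmul _ _ _ hterm).trans ?_
  rw [nsmul_eq_mul, div_eq_mul_inv, ENNReal.ofReal_mul (by positivity), ENNReal.ofReal_natCast,
    ENNReal.ofReal_inv_of_pos hβ]
  gcongr
  exact_mod_cast (Finset.card_le_univ _).trans_eq (Fintype.card_fin N)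

theorem le_coulombCost {N : ℕ} {i j : Fin N} (hij : i ≠ j) (x : Config N) :
    coulombCostWithout i x + (ENNReal.ofReal ‖x i - x j‖)⁻¹ ≤ coulombCost x := by
  rw [coulombCost_eq i]
  gcongr
  exact Finset.single_le_sum (f := fun l => (ENNReal.ofReal ‖x i - x l‖)⁻¹)
    (fun _ _ => zero_le) (Finset.mem_erase.2 ⟨hij.symm, Finset.mem_univ _⟩)

/-! ### Exchanging one point between two configurations -/

/-- The pairs of configurations for which exchanging the `i`-th points lowers the cost: in `x` the
points `i` and `j` are close, and the exchanged points are far from all others. -/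
def exchangeSet {N : ℕ} (i j : Fin N) (α β : ℝ) : Set (Config N × Config N) :=
  {p | ‖p.1 i - p.1 j‖ ≤ α ∧ ∀ k, k ≠ i → β ≤ ‖p.2 i - p.1 k‖ ∧ β ≤ ‖p.1 i - p.2 k‖}

theorem measurableSet_exchangeSet {N : ℕ} (i j : Fin N) (α β : ℝ) :
    MeasurableSet (exchangeSet i j α β) := by
  unfold exchangeSet
  refine MeasurableSet.inter (s₁ := {p : Config N × Config N | ‖p.1 i - p.1 j‖ ≤ α})
    (measurableSet_le (by fun_prop) (by fun_prop)) ?_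
  have : {p : Config N × Config N |
      ∀ k, k ≠ i → β ≤ ‖p.2 i - p.1 k‖ ∧ β ≤ ‖p.1 i - p.2 k‖} =
      ⋂ k, ⋂ (_ : k ≠ i), ({p | β ≤ ‖p.2 i - p.1 k‖} ∩ {p | β ≤ ‖p.1 i - p.2 k‖}) := by
    ext p; simp
  change MeasurableSet {p : Config N × Config N |
      ∀ k, k ≠ i → β ≤ ‖p.2 i - p.1 k‖ ∧ β ≤ ‖p.1 i - p.2 k‖}
  rw [this]
  refine MeasurableSet.iInter fun k => MeasurableSet.iInter fun _ => ?_
  exact (measurableSet_le (by fun_prop) (by fun_prop)).inter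
    (measurableSet_le (by fun_prop) (by fun_prop))

/-- The exchanged points contribute at most N/β in each new configuration, while the lost
interaction between x_i and x_j is at least 2N/β + 1. The gain stands on the left to avoid truncated
subtraction. -/
theorem coulombCost_exchange_add_one_le {N : ℕ} {i j : Fin N} (hij : i ≠ j) {β : ℝ} (hβ : 0 < β)
    {p : Config N × Config N} (hp : p ∈ exchangeSet i j (2 * (N / β) + 1)⁻¹ β) :
    coulombCost (Function.update p.1 i (p.2 i)) + coulombCost (Function.update p.2 i (p.1 i)) + 1 ≤
      coulombCost p.1 + coulombCost p.2 := by
  obtain ⟨x, y⟩ := p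
  obtain ⟨hα, hfar⟩ := hp
  have h1 := coulombCost_update_le i x (y i) hβ fun k hk => (hfar k hk).1
  have h2 := coulombCost_update_le i y (x i) hβ fun k hk => (hfar k hk).2
  have h3 := le_coulombCost hij x
  have h4 : coulombCostWithout i y ≤ coulombCost y := by rw [coulombCost_eq i]; exact le_self_add
  have h5 : ENNReal.ofReal (N / β) + ENNReal.ofReal (N / β) + 1 ≤
      (ENNReal.ofReal ‖x i - x j‖)⁻¹ := by
    rw [← ENNReal.ofReal_one, ← ENNReal.ofReal_add (by positivity) (by positivity),
      ← ENNReal.ofReal_add (by positivity) (by positivity), ← two_mul, ← inv_inv (2 * (N / β) + 1),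
      ENNReal.ofReal_inv_of_pos (by positivity)]
    exact ENNReal.inv_le_inv.2 (ENNReal.ofReal_le_ofReal hα)
  calc _ ≤ (coulombCostWithout i x + ENNReal.ofReal (N / β)) +
        (coulombCostWithout i y + ENNReal.ofReal (N / β)) + 1 := by gcongr
    _ = (coulombCostWithout i x + (ENNReal.ofReal (N / β) + ENNReal.ofReal (N / β) + 1)) +
        coulombCostWithout i y := by ring
    _ ≤ _ := by gcongr; exact (add_le_add_right h5 _).trans h3

open Classical in
/-- Exchange the `i`-th points of the two configurations on the set `S`. -/
noncomputable def exchangeOn {N : ℕ} (i : Fin N) (S : Set (Config N × Config N))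
    (p : Config N × Config N) : Config N × Config N :=
  if p ∈ S then (Function.update p.1 i (p.2 i), Function.update p.2 i (p.1 i)) else p

theorem measurable_exchangeOn {N : ℕ} (i : Fin N) {S : Set (Config N × Config N)}
    (hS : MeasurableSet S) : Measurable (exchangeOn i S) := by
  classical
  unfold exchangeOn
  refine Measurable.ite hS (Measurable.prodMk ?_ ?_) measurable_id
  · refine measurable_pi_lambda _ fun k => ?_
    by_cases hk : k = i
    · subst hk; simp only [Function.update_self]; fun_prop
    · simp only [Function.update_of_ne hk]; fun_prop
  · refine measurable_pi_lambda _ fun k => ?_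
    by_cases hk : k = i
    · subst hk; simp only [Function.update_self]; fun_prop
    · simp only [Function.update_of_ne hk]; fun_prop

theorem exchangeOn_apply {N : ℕ} (i k : Fin N) (S : Set (Config N × Config N))
    (p : Config N × Config N) :
    ((exchangeOn i S p).1 k = p.1 k ∧ (exchangeOn i S p).2 k = p.2 k) ∨
      ((exchangeOn i S p).1 k = p.2 k ∧ (exchangeOn i S p).2 k = p.1 k) := by
  unfold exchangeOn
  split_ifs
  · by_cases hk : k = i
    · subst hk; right; simp
    · left; simp [hk]
  · left; simp

/-- The average of the two marginals of a measure on pairs of configurations. -/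
noncomputable def averageMarginal {N : ℕ} (R : Measure (Config N × Config N)) :
    Measure (Config N) :=
  (2 : ℝ≥0∞)⁻¹ • (R.map Prod.fst + R.map Prod.snd)

theorem lintegral_averageMarginal {N : ℕ} (R : Measure (Config N × Config N))
    {g : Config N → ℝ≥0∞} (hg : Measurable g) :
    ∫⁻ x, g x ∂(averageMarginal R) = 2⁻¹ * ∫⁻ p, (g p.1 + g p.2) ∂ R := by
  rw [averageMarginal, lintegral_smul_measure, lintegral_add_measure,
    lintegral_map hg measurable_fst, lintegral_map hg measurable_snd,
    smul_eq_mul, ← lintegral_add_left (by fun_prop)]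

theorem lintegral_prod_self_add {Ω : Type*} [MeasurableSpace Ω] (P : Measure Ω)
    [IsProbabilityMeasure P] {g : Ω → ℝ≥0∞} (hg : Measurable g) :
    ∫⁻ p, (g p.1 + g p.2) ∂(P.prod P) = 2 * ∫⁻ x, g x ∂P := by
  rw [lintegral_add_left (by fun_prop), measurePreserving_fst.lintegral_comp hg,
    measurePreserving_snd.lintegral_comp hg, two_mul]

/-- For each k the exchange preserves the unordered pair {x_k, y_k}, whatever `S` is. One component
alone may change its marginals, but the average of the two does not. -/
theorem averageMarginal_exchange_plan {N : ℕ} {ρ : ProbabilityMeasure E3}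
    {P : ProbabilityMeasure (Config N)} (hP : P ∈ transportPlans N ρ) (i : Fin N)
    {S : Set (Config N × Config N)} (hS : MeasurableSet S) :
    ∃ P' ∈ transportPlans N ρ, ∀ g : Config N → ℝ≥0∞, Measurable g →
      ∫⁻ x, g x ∂(P' : Measure (Config N)) =
        2⁻¹ * ∫⁻ p, (g (exchangeOn i S p).1 + g (exchangeOn i S p).2)
          ∂((P : Measure (Config N)).prod (P : Measure (Config N))) := by
  have hT := measurable_exchangeOn i hS
  set R := (P : Measure (Config N)).prod (P : Measure (Config N)) with hR
  have hint : ∀ g : Config N → ℝ≥0∞, Measurable g →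
      ∫⁻ x, g x ∂(averageMarginal (R.map (exchangeOn i S))) =
        2⁻¹ * ∫⁻ p, (g (exchangeOn i S p).1 + g (exchangeOn i S p).2) ∂ R := by
    intro g hg
    rw [lintegral_averageMarginal _ hg, lintegral_map _ hT]
    exact (hg.comp measurable_fst).add (hg.comp measurable_snd)
  have hprob : IsProbabilityMeasure (averageMarginal (R.map (exchangeOn i S))) := by
    refine ⟨?_⟩
    rw [← lintegral_one, hint (fun _ => 1) measurable_const]
    simp only [lintegral_const, hR, measure_univ, mul_one]
    rw [one_add_one_eq_two, ENNReal.inv_mul_cancel (by simp) (by simp)]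
  refine ⟨⟨averageMarginal (R.map (exchangeOn i S)), hprob⟩, fun k => ?_, hint⟩
  refine Measure.ext_of_lintegral _ fun g hg => ?_
  rw [lintegral_map hg (measurable_pi_apply k)]
  change ∫⁻ x, g (x k) ∂(averageMarginal (R.map (exchangeOn i S))) = _
  have hgk : Measurable fun x : Config N => g (x k) := hg.comp (measurable_pi_apply k)
  have hpt : ∀ p : Config N × Config N,
      g ((exchangeOn i S p).1 k) + g ((exchangeOn i S p).2 k) = g (p.1 k) + g (p.2 k) := by
    intro p
    rcases exchangeOn_apply i k S p with ⟨h1, h2⟩ | ⟨h1, h2⟩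
    · rw [h1, h2]
    · rw [h1, h2, add_comm]
  have hPk : ∫⁻ x, g (x k) ∂(P : Measure (Config N)) = ∫⁻ z, g z ∂(ρ : Measure E3) := by
    rw [← hP k, lintegral_map hg (measurable_pi_apply k)]
  rw [hint _ hgk, lintegral_congr hpt, hR, lintegral_prod_self_add _ hgk, hPk, ← mul_assoc,
    ENNReal.inv_mul_cancel (by simp) (by simp), one_mul]

/-- The exchanged plan costs less than P by at least half the mass of the exchange set, so
minimality forces that mass to vanish. -/
theorem prod_exchangeSet_eq_zero {N : ℕ} {ρ : ProbabilityMeasure E3}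
    {P : ProbabilityMeasure (Config N)} (hP : P ∈ transportPlans N ρ)
    (hfin : ∫⁻ x, coulombCost x ∂(P : Measure (Config N)) ≠ ⊤)
    (hmin : ∀ P' ∈ transportPlans N ρ, ∫⁻ x, coulombCost x ∂(P : Measure (Config N)) ≤
      ∫⁻ x, coulombCost x ∂(P' : Measure (Config N)))
    {i j : Fin N} (hij : i ≠ j) {β : ℝ} (hβ : 0 < β) :
    ((P : Measure (Config N)).prod (P : Measure (Config N)))
      (exchangeSet i j (2 * (N / β) + 1)⁻¹ β) = 0 := by
  set S := exchangeSet i j (2 * (N / β) + 1)⁻¹ β with hSdef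
  have hS : MeasurableSet S := measurableSet_exchangeSet _ _ _ _
  obtain ⟨P', hP', hint⟩ := averageMarginal_exchange_plan hP i hS
  have hle := hmin P' hP'
  rw [hint _ measurable_coulombCost] at hle
  set R := (P : Measure (Config N)).prod (P : Measure (Config N)) with hR
  have hc := measurable_coulombCost (N := N)
  have hpt : ∀ p, (coulombCost (exchangeOn i S p).1 + coulombCost (exchangeOn i S p).2) +
      S.indicator 1 p ≤ coulombCost p.1 + coulombCost p.2 := by
    intro p
    by_cases hp : p ∈ S
    · simpa [exchangeOn, hp] using coulombCost_exchange_add_one_le hij hβ hp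
    · simp [exchangeOn, hp]
  have hsum : ∫⁻ p, (coulombCost p.1 + coulombCost p.2) ∂ R =
      2 * ∫⁻ x, coulombCost x ∂(P : Measure (Config N)) :=
    lintegral_prod_self_add _ hc
  have hmono := lintegral_mono (μ := R) hpt
  rw [lintegral_add_right _ (measurable_one.indicator hS), lintegral_indicator_one hS, hsum] at hmono
  set I := ∫⁻ p, (coulombCost (exchangeOn i S p).1 + coulombCost (exchangeOn i S p).2) ∂ R
  set J := ∫⁻ x, coulombCost x ∂(P : Measure (Config N))
  have hJI : 2 * J ≤ I := by
    calc 2 * J ≤ 2 * (2⁻¹ * I) := by gcongr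
      _ = I := by rw [← mul_assoc, ENNReal.mul_inv_cancel (by simp) (by simp), one_mul]
  -- Finite cost is what permits cancelling `2 * J` from both sides.
  have hJtop : 2 * J ≠ ⊤ := ENNReal.mul_ne_top (by simp) hfin
  have h : 2 * J + R S ≤ 2 * J + 0 := by
    rw [add_zero]; exact (add_le_add_left hJI _).trans hmono
  exact le_antisymm ((ENNReal.add_le_add_iff_left hJtop).1 h) zero_le

/-- Every configuration has configurations, charged by the plan, whose points are far from it. -/
theorem measure_far_pos {N : ℕ} {ρ : ProbabilityMeasure E3} {P : ProbabilityMeasure (Config N)}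
    (hP : P ∈ transportPlans N ρ) {β : ℝ}
    (hβ : ∀ x, ((2 * N : ℕ) : ℝ≥0∞) * (ρ : Measure E3) {y | ‖x - y‖ < β} < 1)
    (i : Fin N) (x : Config N) :
    (P : Measure (Config N)) {y | ∀ k, k ≠ i → β ≤ ‖y i - x k‖ ∧ β ≤ ‖x i - y k‖} ≠ 0 := by
  intro h0
  set G := {y : Config N | ∀ k, k ≠ i → β ≤ ‖y i - x k‖ ∧ β ≤ ‖x i - y k‖} with hG
  have hball : ∀ (z : E3), MeasurableSet {y | ‖z - y‖ < β} := fun z =>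
    measurableSet_lt (by fun_prop) measurable_const
  have hPb : ∀ (k : Fin N) (z : E3), (P : Measure (Config N)) {y | ‖z - y k‖ < β} =
      (ρ : Measure E3) {y | ‖z - y‖ < β} := by
    intro k z
    rw [← hP k, Measure.map_apply (measurable_pi_apply k) (hball z)]
    rfl
  have hcover : (Set.univ : Set (Config N)) ⊆
      G ∪ ⋃ k ∈ (Finset.univ : Finset (Fin N)),
        ({y | ‖x k - y i‖ < β} ∪ {y | ‖x i - y k‖ < β}) := by
    intro y _
    by_cases hy : y ∈ G
    · exact Or.inl hy
    · right
      simp only [hG, Set.mem_ofPred_eq, not_forall, not_and_or, not_le] at hy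
      obtain ⟨k, -, hk⟩ := hy
      simp only [Finset.mem_univ, Set.iUnion_true, Set.mem_iUnion]
      refine ⟨k, ?_⟩
      rcases hk with hk | hk
      · left
        change ‖x k - y i‖ < β
        rwa [norm_sub_rev]
      · exact Or.inr hk
  have hone : (1 : ℝ≥0∞) ≤ ∑ k, ((ρ : Measure E3) {y | ‖x k - y‖ < β} +
      (ρ : Measure E3) {y | ‖x i - y‖ < β}) := by
    calc (1 : ℝ≥0∞) = (P : Measure (Config N)) Set.univ := measure_univ.symm
      _ ≤ _ := (measure_mono hcover).trans (measure_union_le _ _)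
      _ ≤ 0 + ∑ k, (P : Measure (Config N))
          ({y | ‖x k - y i‖ < β} ∪ {y | ‖x i - y k‖ < β}) := by
        rw [h0]; gcongr; exact measure_biUnion_finset_le _ _
      _ ≤ _ := by
        rw [zero_add]
        refine Finset.sum_le_sum fun k _ => (measure_union_le _ _).trans_eq ?_
        rw [hPb, hPb]
  -- The 2N balls each have mass below 1/(2N), so they cannot cover a set of mass 1; the index k = i
  -- is included harmlessly.
  have hlt : ((2 * N : ℕ) : ℝ≥0∞) * ∑ k, ((ρ : Measure E3) {y | ‖x k - y‖ < β} +
      (ρ : Measure E3) {y | ‖x i - y‖ < β}) < ∑ k : Fin N, (1 + 1) := by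
    rw [Finset.mul_sum]
    refine ENNReal.sum_lt_sum_of_nonempty ⟨i, Finset.mem_univ _⟩ fun k _ => ?_
    rw [mul_add]
    exact ENNReal.add_lt_add (hβ _) (hβ _)
  have hge := mul_le_mul_right hone ((2 * N : ℕ) : ℝ≥0∞)
  have hsum : ∑ k : Fin N, ((1 : ℝ≥0∞) + 1) = ((2 * N : ℕ) : ℝ≥0∞) * 1 := by
    rw [Finset.sum_const, Finset.card_univ, Fintype.card_fin, nsmul_eq_mul, one_add_one_eq_two]
    push_cast
    ring
  rw [hsum] at hlt
  exact absurd (hge.trans_lt hlt) (lt_irrefl _)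

/-- For x with x_i and x_j close, the section of the exchange set at x is the non-null set of far
partners, whereas almost every section is null. -/
theorem measure_near_eq_zero {N : ℕ} {P : Measure (Config N)} [IsProbabilityMeasure P]
    {i j : Fin N} {α β : ℝ}
    (hfar : ∀ x : Config N, P {y | ∀ k, k ≠ i → β ≤ ‖y i - x k‖ ∧ β ≤ ‖x i - y k‖} ≠ 0)
    (h : (P.prod P) (exchangeSet i j α β) = 0) :
    P {x | ‖x i - x j‖ ≤ α} = 0 := by
  rw [Measure.measure_prod_null (measurableSet_exchangeSet i j α β)] at h
  refine measure_mono_null ?_ h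
  intro x hx h0
  have hx' : ‖x i - x j‖ ≤ α := hx
  refine hfar x ?_
  refine measure_mono_null ?_ (show P (Prod.mk x ⁻¹' exchangeSet i j α β) = 0 from h0)
  intro y hy
  exact ⟨hx', hy⟩

/-! ### A plan of finite cost -/

/-- A plan, for an atomless marginal, under which the points keep a fixed distance. -/
theorem exists_separated_plan {N : ℕ} (hN : 0 < N) (ρ : ProbabilityMeasure E3)
    (hρ : ∀ x : E3, (ρ : Measure E3) {x} = 0) :
    ∃ P ∈ transportPlans N ρ, ∃ δ : ℝ, 0 < δ ∧
      ∀ᵐ x ∂(P : Measure (Config N)), ∀ i j, i ≠ j → δ ≤ ‖x i - x j‖ := by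
  obtain ⟨m, hm⟩ : ∃ m, m + 1 = 2 * N := ⟨2 * N - 1, by omega⟩
  obtain ⟨κ, δ, hκ, hδ, hmass, hadj⟩ := exists_equal_mass_slabs (ρ : Measure E3) hρ m
  -- Even shifts modulo the even number 2N keep distinct points out of equal or adjacent slabs.
  let s : Fin N → Fin (m + 1) := fun i => ⟨2 * i, by omega⟩
  have hA : ∀ k, MeasurableSet (κ ⁻¹' {k}) := fun k => hκ (measurableSet_singleton k)
  have hA0 : ∀ k, (ρ : Measure E3) (κ ⁻¹' {k}) ≠ 0 := fun k => by
    rw [hmass]; exact ENNReal.inv_ne_zero.2 (ENNReal.natCast_ne_top _)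
  let μ : Fin (m + 1) → Measure E3 := fun k => ProbabilityTheory.cond (ρ : Measure E3) (κ ⁻¹' {k})
  have hμ : ∀ k, IsProbabilityMeasure (μ k) := fun k =>
    ProbabilityTheory.cond_isProbabilityMeasure (hA0 k)
  have hMne : ((m + 1 : ℕ) : ℝ≥0∞) ≠ 0 := by simp
  have hMtop : ((m + 1 : ℕ) : ℝ≥0∞) ≠ ⊤ := ENNReal.natCast_ne_top _
  let Q : Measure (Config N) :=
    ((m + 1 : ℕ) : ℝ≥0∞)⁻¹ • ∑ k : Fin (m + 1), Measure.pi fun i => μ (k + s i)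
  have hQ : IsProbabilityMeasure Q := by
    refine ⟨?_⟩
    simp only [Q, Measure.smul_apply, Measure.finsetSum_apply, measure_univ, Finset.sum_const,
      Finset.card_univ, Fintype.card_fin, smul_eq_mul, nsmul_eq_mul, mul_one]
    exact ENNReal.inv_mul_cancel hMne hMtop
  -- Equal slab masses make the uniform average of the conditional laws equal to ρ.
  have hsumμ : ((m + 1 : ℕ) : ℝ≥0∞)⁻¹ • ∑ k, μ k = (ρ : Measure E3) := by
    have h : ∀ k, μ k = ((m + 1 : ℕ) : ℝ≥0∞) • (ρ : Measure E3).restrict (κ ⁻¹' {k}) := fun k => by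
      simp only [μ, ProbabilityTheory.cond, hmass, inv_inv]
    simp only [h]
    rw [← Finset.smul_sum, smul_smul, ENNReal.inv_mul_cancel hMne hMtop, one_smul]
    rw [← Measure.sum_fintype, ← Measure.restrict_iUnion _ hA]
    · rw [← Set.preimage_iUnion, Set.iUnion_of_singleton, Set.preimage_univ, Measure.restrict_univ]
    · intro a b hab
      exact Disjoint.preimage _ (Set.disjoint_singleton.2 hab)
  refine ⟨⟨Q, hQ⟩, fun i => ?_, δ, hδ, ?_⟩
  · change Q.map (fun x => x i) = _
    have hev : ∀ k : Fin (m + 1), (Measure.pi fun i => μ (k + s i)).map (fun x => x i) = μ (k + s i) :=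
      fun k => (measurePreserving_eval (fun i => μ (k + s i)) i).map_eq
    rw [Measure.map_smul, Measure.map_finset_sum (measurable_pi_apply i).aemeasurable]
    simp only [hev]
    rw [← hsumμ]
    congr 1
    -- Shifting by `s i` permutes the slabs, so each marginal is the same uniform average.
    exact Equiv.sum_comp (Equiv.addRight (s i)) μ
  · change ∀ᵐ x ∂Q, _
    refine Measure.ae_smul_measure ?_ _
    rw [← Measure.sum_fintype, Measure.ae_sum_iff]
    intro k
    have hcell : ∀ᵐ x ∂(Measure.pi fun i => μ (k + s i)), ∀ i, κ (x i) = k + s i := by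
      refine ae_all_iff.2 fun i => ?_
      have h : ∀ᵐ z ∂(μ (k + s i)), κ z = k + s i :=
        ProbabilityTheory.ae_cond_mem (hA (k + s i))
      exact (measurePreserving_eval (fun i => μ (k + s i)) i).quasiMeasurePreserving.ae h
    filter_upwards [hcell] with x hx i j hij
    by_contra! hlt
    have h1 := hadj _ _ hlt.le
    have h2 := hadj (x j) (x i) (by rw [norm_sub_rev]; exact hlt.le)
    have hval : ∀ i : Fin N, ((k + s i : Fin (m + 1)) : ℕ) = k + 2 * i ∨
        ((k + s i : Fin (m + 1)) : ℕ) + 2 * N = k + 2 * i := by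
      intro i
      have hk := k.isLt
      have hi := i.isLt
      rw [Fin.val_add]
      change ((k : ℕ) + 2 * (i : ℕ)) % (m + 1) = _ ∨ ((k : ℕ) + 2 * (i : ℕ)) % (m + 1) + _ = _
      by_cases h : (k : ℕ) + 2 * (i : ℕ) < m + 1
      · left; exact Nat.mod_eq_of_lt h
      · right
        rw [Nat.mod_eq_sub_mod (by omega), Nat.mod_eq_of_lt (by omega)]
        omega
    have hne : (i : ℕ) ≠ j := fun h => hij (Fin.ext h)
    rw [hx i, hx j] at h1 h2
    have := (k + s i).isLt
    have := (k + s j).isLt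
    have := i.isLt
    have := j.isLt
    -- In every wrap-around case the slab indices differ by a nonzero even number, contradicting
    -- adjacency.
    rcases hval i with h | h <;> rcases hval j with h' | h' <;> omega

/-- An atomless marginal admits a plan of finite Coulomb cost. -/
theorem exists_plan_lintegral_coulombCost_ne_top {N : ℕ} (hN : 0 < N) (ρ : ProbabilityMeasure E3)
    (hρ : ∀ x : E3, (ρ : Measure E3) {x} = 0) :
    ∃ P ∈ transportPlans N ρ, ∫⁻ x, coulombCost x ∂(P : Measure (Config N)) ≠ ⊤ := by
  obtain ⟨P, hP, δ, hδ, hsep⟩ := exists_separated_plan hN ρ hρ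
  refine ⟨P, hP, ?_⟩
  have hle : ∀ᵐ x ∂(P : Measure (Config N)), coulombCost x ≤
      ∑ i : Fin N, ∑ _j ∈ Finset.Ioi i, (ENNReal.ofReal δ)⁻¹ := by
    filter_upwards [hsep] with x hx
    refine Finset.sum_le_sum fun i _ => Finset.sum_le_sum fun j hj => ?_
    exact ENNReal.inv_le_inv.2 (ENNReal.ofReal_le_ofReal (hx i j (Finset.mem_Ioi.1 hj).ne))
  refine ((lintegral_mono_ae hle).trans_lt ?_).ne
  rw [lintegral_const, measure_univ, mul_one]
  refine ENNReal.sum_lt_top.2 fun i _ => ENNReal.sum_lt_top.2 fun j _ => ?_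
  rw [ENNReal.inv_lt_top, ENNReal.ofReal_pos]
  exact hδ

/-! ### Conclusion for minimizers -/

theorem mainTheorem2 (N : ℕ) (ρ : ProbabilityMeasure E3)
    (hρ : ∀ x : E3, (ρ : Measure E3) {x} = 0) :
    ∃ α : ℝ, 0 < α ∧
      ∀ P : ProbabilityMeasure (Config N),
        IsMinOn (transportFunctional coulombCost ρ) Set.univ P →
          (P : Measure (Config N)) (diagonalStrip N α) = 0 := by
  obtain ⟨β, hβ, hball⟩ := exists_measure_ball_lt (ρ : Measure E3) hρ (2 * N)
  refine ⟨(2 * (N / β) + 1)⁻¹, by positivity, fun P hmin => ?_⟩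
  have hstrip : diagonalStrip N (2 * (N / β) + 1)⁻¹ =
      ⋃ i : Fin N, ⋃ j : Fin N, ⋃ (_ : i ≠ j), {x | ‖x i - x j‖ ≤ (2 * (N / β) + 1)⁻¹} := by
    ext x; simp [diagonalStrip]
  rw [hstrip]
  refine measure_iUnion_null fun i => measure_iUnion_null fun j => measure_iUnion_null fun hij => ?_
  -- A finite-cost competitor shows that a minimizer is a plan of finite cost; the index i supplies
  -- N > 0.
  obtain ⟨P₀, hP₀, hfin₀⟩ := exists_plan_lintegral_coulombCost_ne_top i.pos ρ hρ
  have hminP : ∀ P', transportFunctional coulombCost ρ P ≤ transportFunctional coulombCost ρ P' :=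
    fun P' => isMinOn_univ_iff.1 hmin P'
  have hP : P ∈ transportPlans N ρ := by
    by_contra hP
    have h := hminP P₀
    rw [transportFunctional, if_neg hP, transportFunctional, if_pos hP₀, top_le_iff] at h
    exact hfin₀ h
  have hminP' : ∀ P' ∈ transportPlans N ρ, ∫⁻ x, coulombCost x ∂(P : Measure (Config N)) ≤
      ∫⁻ x, coulombCost x ∂(P' : Measure (Config N)) := by
    intro P' hP'
    have h := hminP P'
    rwa [transportFunctional, if_pos hP, transportFunctional, if_pos hP'] at h
  have hfin := ne_top_of_le_ne_top hfin₀ (hminP' P₀ hP₀)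
  exact measure_near_eq_zero (measure_far_pos hP hball i)
    (prod_exchangeSet_eq_zero hP hfin hminP' hij hβ)
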